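/- Let $G$ be a finite simple graph with adjacency matrix $A$, let $\mathbf{j}$ be the all-ones vector and $\mathbf{d} = A\mathbf{j}$ the vector of valencies (vertex degrees). An eigenvalue of $A$ is a main eigenvalue of $G$ if it has an eigenvector that is not orthogonal to $\mathbf{j}$. For real numbers $\alpha, \beta$, the graph $G$ is called 2-walk $(\alpha,\beta)$-linear if $G$ is not regular and $A\mathbf{d} = \alpha \mathbf{d} + \beta \mathbf{j}$. For every positive integer $t$ there exist integers $\alpha \ge 0$ and $\beta$ and a finite connected simple graph $G$ such that $G$ is 2-walk $(\alpha,\beta)$-linear, $G$ has exactly two main eigenvalues, and $G$ has at least $t$ distinct valencies. In particular, the number of distinct valencies of connected graphs with exactly two main eigenvalues is unbounded. -/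

import Mathlib

namespace SimpleGraph

variable {V : Type*} [Fintype V] [DecidableEq V]

/-- `μ` is a main eigenvalue of `G`: the adjacency matrix has an eigenvector for `μ` that is not
orthogonal to the all-ones vector. -/
def IsMainEigenvalue (G : SimpleGraph V) [DecidableRel G.Adj] (μ : ℝ) : Prop :=
  ∃ x : V → ℝ, Module.End.HasEigenvector (Matrix.toLin' (G.adjMatrix ℝ)) μ x ∧
    dotProduct x (1 : V → ℝ) ≠ 0

/-- `G` has exactly `k` (distinct) main eigenvalues. -/
def HasExactlyMainEigenvalues (G : SimpleGraph V) [DecidableRel G.Adj] (k : ℕ) : Prop :=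
  {μ : ℝ | G.IsMainEigenvalue μ}.Finite ∧ {μ : ℝ | G.IsMainEigenvalue μ}.ncard = k

/-- The vector of valencies, `A j` with `j` the all-ones vector. -/
def valencyVector (G : SimpleGraph V) [DecidableRel G.Adj] : V → ℝ :=
  Matrix.mulVec (G.adjMatrix ℝ) (1 : V → ℝ)

/-- `G` is 2-walk `(α, β)`-linear: it is not regular and `A d = α d + β j`. -/
def IsTwoWalkLinear (G : SimpleGraph V) [DecidableRel G.Adj] (α β : ℝ) : Prop :=
  (¬ ∃ k : ℕ, G.IsRegularOfDegree k) ∧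
    Matrix.mulVec (G.adjMatrix ℝ) G.valencyVector = α • G.valencyVector + β • (1 : V → ℝ)

/-- The finite set of distinct valencies of `G`. -/
def valencies (G : SimpleGraph V) [DecidableRel G.Adj] : Finset ℕ :=
  Finset.univ.image fun v => G.degree v

end SimpleGraph

/-!
A family of graphs is built whose valency partition is equitable with one central class and `t + 1`
outer classes. The central vertices are the points of a grid `∏ i, Fin (x i)`. Every line of the
grid in direction `i` carries a clique on `b i` new vertices, all joined to the points of that line.
Any two points are linked by correcting coordinates one at a time, so the graph is connected.

With `B = ∑ j, b j`, each point has valency `B`. If `x i + b i + δ i = B + 1` then the clique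
vertices in direction `i` have valency `B - δ i`, so distinct positive `δ i` give `t + 2` valencies.
Writing the neighbour sums of valencies out, the graph is 2-walk linear with `α = B - 1 - M` as soon
as `δ i * (b i + M)` is the same number `∑ j, b j * δ j` for all `i`
(`SimpleGraph.sum_degree_lineCliqueGraph`). These equations are solved in positive integers by
`exists_blockSizes`.

That there are exactly two main eigenvalues is a general fact about 2-walk linear graphs
(`SimpleGraph.IsTwoWalkLinear.hasExactlyMainEigenvalues_two`). Pairing an eigenvector with
`A d = α d + β j` shows that a main eigenvalue is a root of `X² - αX - β`. Conversely, this quadratic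
has two distinct real roots `μ, ν`, and `d - ν j` is an eigenvector for `μ` that is not orthogonal
to `j`.
-/

namespace SimpleGraph

/-! ### Main eigenvalues of 2-walk linear graphs -/

section MainEigenvalues

variable {V : Type*} [Fintype V] (G : SimpleGraph V) [DecidableRel G.Adj]

theorem valencyVector_apply (v : V) : G.valencyVector v = G.degree v := by
  simp [valencyVector, Matrix.mulVec, dotProduct, adjMatrix_apply, ← card_neighborFinset_eq_degree,
    neighborFinset_eq_filter]

theorem adjMatrix_mulVec_dotProduct (x y : V → ℝ) :
    (G.adjMatrix ℝ).mulVec x ⬝ᵥ y = x ⬝ᵥ (G.adjMatrix ℝ).mulVec y := by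
  rw [Matrix.dotProduct_mulVec, ← Matrix.mulVec_transpose, transpose_adjMatrix]

variable {G}

/-- For a 2-walk `(α, β)`-linear graph the valencies satisfy `d ⬝ d = α (d ⬝ j) + β (j ⬝ j)`. -/
theorem IsTwoWalkLinear.dotProduct_self {α β : ℝ} (h : G.IsTwoWalkLinear α β) :
    G.valencyVector ⬝ᵥ G.valencyVector = α * (G.valencyVector ⬝ᵥ 1) + β * ((1 : V → ℝ) ⬝ᵥ 1) := by
  have h2 := congrArg (fun y => (1 : V → ℝ) ⬝ᵥ y) h.2
  simp only [← adjMatrix_mulVec_dotProduct, dotProduct_add, dotProduct_smul, smul_eq_mul] at h2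
  rw [dotProduct_comm 1 G.valencyVector] at h2
  exact h2

theorem IsTwoWalkLinear.valencyVector_ne_smul {α β : ℝ} (h : G.IsTwoWalkLinear α β) (c : ℝ) :
    G.valencyVector ≠ c • (1 : V → ℝ) := by
  intro hc
  rcases isEmpty_or_nonempty V with hV | ⟨⟨w⟩⟩
  · exact h.1 ⟨0, fun v => hV.elim v⟩
  · refine h.1 ⟨G.degree w, fun v => ?_⟩
    have hv := congrFun hc v
    have hw := congrFun hc w
    rw [valencyVector_apply] at hv hw
    exact_mod_cast hv.trans hw.symm

/-- The quadratic `X² - αX - β` sums to zero over the valencies, so it cannot be positive at all of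
them, and if it were a square then every valency would be its double root. -/
theorem IsTwoWalkLinear.discrim_pos {α β : ℝ} (h : G.IsTwoWalkLinear α β) :
    0 < α ^ 2 + 4 * β := by
  by_contra! hneg
  have hsq : (G.valencyVector - (α / 2) • (1 : V → ℝ)) ⬝ᵥ
      (G.valencyVector - (α / 2) • (1 : V → ℝ)) =
        (α ^ 2 + 4 * β) / 4 * ((1 : V → ℝ) ⬝ᵥ 1) := by
    simp only [sub_dotProduct, dotProduct_sub, smul_dotProduct, dotProduct_smul, smul_eq_mul,
      h.dotProduct_self, dotProduct_comm 1 G.valencyVector]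
    ring
  have hcard : (0 : ℝ) ≤ (1 : V → ℝ) ⬝ᵥ 1 := by simp
  have hzero := dotProduct_self_eq_zero.1 (le_antisymm
    (hsq.trans_le (mul_nonpos_of_nonpos_of_nonneg (by linarith) hcard))
    (Finset.sum_nonneg fun v _ => mul_self_nonneg _))
  exact h.valencyVector_ne_smul _ (sub_eq_zero.1 hzero)

theorem isTwoWalkLinear_of_sum_degree {α β : ℤ} (hreg : ¬ ∃ k : ℕ, G.IsRegularOfDegree k)
    (h : ∀ v, ((∑ u ∈ G.neighborFinset v, G.degree u : ℕ) : ℤ) = α * G.degree v + β) :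
    G.IsTwoWalkLinear α β := by
  refine ⟨hreg, ?_⟩
  ext v
  rw [adjMatrix_mulVec_apply]
  simp only [valencyVector_apply, Pi.add_apply, Pi.smul_apply, smul_eq_mul, Pi.one_apply, mul_one]
  exact_mod_cast h v

variable [DecidableEq V]

theorem IsTwoWalkLinear.isMainEigenvalue_root {α β μ : ℝ} (h : G.IsTwoWalkLinear α β)
    (hμ : G.IsMainEigenvalue μ) : μ ^ 2 - α * μ - β = 0 := by
  obtain ⟨x, hx, hj⟩ := hμ
  have hx' : (G.adjMatrix ℝ).mulVec x = μ • x := by simpa using hx.apply_eq_smul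
  have h1 : x ⬝ᵥ G.valencyVector = μ * (x ⬝ᵥ 1) := by
    rw [valencyVector, ← adjMatrix_mulVec_dotProduct, hx', smul_dotProduct, smul_eq_mul]
  have h2 := congrArg (fun y => x ⬝ᵥ y) h.2
  simp only [← adjMatrix_mulVec_dotProduct, hx', smul_dotProduct, dotProduct_add,
    dotProduct_smul, smul_eq_mul, h1] at h2
  apply mul_right_cancel₀ hj
  linarith

/-- If `μ, ν` are the two roots of `X² - αX - β`, then `d - ν j` is an eigenvector for `μ`. It is
orthogonal to `d - μ j`, and `j` is a multiple of the difference of the two. -/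
theorem IsTwoWalkLinear.isMainEigenvalue {α β μ ν : ℝ} (h : G.IsTwoWalkLinear α β)
    (hadd : μ + ν = α) (hmul : μ * ν = -β) : G.IsMainEigenvalue μ := by
  have hne : G.valencyVector - ν • (1 : V → ℝ) ≠ 0 := sub_ne_zero.2 (h.valencyVector_ne_smul ν)
  refine ⟨G.valencyVector - ν • (1 : V → ℝ), ⟨?_, hne⟩, fun h0 => ?_⟩
  · rw [Module.End.mem_eigenspace_iff, Matrix.toLin'_apply, Matrix.mulVec_sub, h.2,
      Matrix.mulVec_smul]
    ext v
    simp only [Pi.sub_apply, Pi.add_apply, Pi.smul_apply, smul_eq_mul, Pi.one_apply, valencyVector]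
    rw [← hadd]
    linear_combination hmul
  · apply hne
    apply dotProduct_self_eq_zero.1
    have h1 : G.valencyVector ⬝ᵥ 1 = ν * ((1 : V → ℝ) ⬝ᵥ 1) := by
      simpa [sub_dotProduct, sub_eq_zero] using h0
    simp only [sub_dotProduct, dotProduct_sub, smul_dotProduct, dotProduct_smul, smul_eq_mul,
      h.dotProduct_self, dotProduct_comm 1 G.valencyVector, h1]
    rw [← hadd]
    linear_combination ((1 : V → ℝ) ⬝ᵥ 1) * hmul

theorem IsTwoWalkLinear.hasExactlyMainEigenvalues_two {α β : ℝ} (h : G.IsTwoWalkLinear α β) :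
    G.HasExactlyMainEigenvalues 2 := by
  set r := √(α ^ 2 + 4 * β) with hr
  have hrpos : 0 < r := Real.sqrt_pos.2 h.discrim_pos
  have hrsq : r * r = α ^ 2 + 4 * β := Real.mul_self_sqrt h.discrim_pos.le
  have hset : {μ : ℝ | G.IsMainEigenvalue μ} = {(α + r) / 2, (α - r) / 2} := by
    ext μ
    simp only [Set.mem_ofPred_eq, Set.mem_insert_iff, Set.mem_singleton_iff]
    constructor
    · intro hμ
      have hroot := h.isMainEigenvalue_root hμ
      have : (μ - (α + r) / 2) * (μ - (α - r) / 2) = 0 := by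
        linear_combination hroot - hrsq / 4
      simpa [sub_eq_zero] using this
    · rintro (rfl | rfl)
      · exact h.isMainEigenvalue (ν := (α - r) / 2) (by ring) (by linear_combination -hrsq / 4)
      · exact h.isMainEigenvalue (ν := (α + r) / 2) (by ring) (by linear_combination -hrsq / 4)
  rw [HasExactlyMainEigenvalues, hset]
  exact ⟨Set.toFinite _, Set.ncard_pair (by intro he; linarith)⟩

end MainEigenvalues

/-! ### Lines of a grid, thickened to cliques -/

section LineCliqueGraph

variable {ι : Type} [DecidableEq ι] {x b : ι → ℕ}

/-- The points of the grid `∏ i, Fin (x i)`. -/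
abbrev GridPoint (x : ι → ℕ) : Type := ∀ i, Fin (x i)

/-- A line of the grid in direction `i`: it fixes every coordinate other than `i`. -/
abbrev GridLine (x : ι → ℕ) (i : ι) : Type := ∀ j : {j // j ≠ i}, Fin (x j)

/-- The line in direction `i` through a point. -/
def GridPoint.line (s : GridPoint x) (i : ι) : GridLine x i := fun j => s j

/-- The vertices are the points of the grid and, for every line in direction `i`, a block of `b i`
vertices. -/
abbrev LineCliqueVertex (x b : ι → ℕ) : Type :=
  GridPoint x ⊕ (Σ l : (Σ i, GridLine x i), Fin (b l.1))

/-- Each block is a clique, and a point is joined to all vertices of the blocks of the lines through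
it. -/
def lineCliqueGraph (x b : ι → ℕ) : SimpleGraph (LineCliqueVertex x b) where
  Adj
    | .inl _, .inl _ => False
    | .inl s, .inr u => s.line u.1.1 = u.1.2
    | .inr u, .inl s => s.line u.1.1 = u.1.2
    | .inr u, .inr w => u ≠ w ∧ u.1 = w.1
  symm := ⟨by
    rintro (s | u) (s' | w) h
    · exact h
    · exact h
    · exact h
    · exact ⟨h.1.symm, h.2.symm⟩⟩
  loopless := ⟨by
    rintro (s | u) h
    · exact h
    · exact h.1 rfl⟩

theorem lineCliqueGraph_reachable_points (hb : ∀ i, 0 < b i) (F : Finset ι) :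
    ∀ s s' : GridPoint x, (∀ j, j ∉ F → s j = s' j) →
      (lineCliqueGraph x b).Reachable (.inl s) (.inl s') := by
  induction F using Finset.induction_on with
  | empty =>
    intro s s' h
    rw [funext fun j => h j (Finset.notMem_empty j)]
  | insert a F ha ih =>
    intro s s' h
    have hline : GridPoint.line (Function.update s a (s' a)) a = s.line a := by
      funext j
      exact Function.update_of_ne j.2 _ _
    -- `s` and the point with its coordinate `a` corrected lie on a common line in direction `a`.
    let m : LineCliqueVertex x b := .inr ⟨⟨a, s.line a⟩, ⟨0, hb a⟩⟩
    have h1 : (lineCliqueGraph x b).Adj (.inl s) m := rfl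
    have h2 : (lineCliqueGraph x b).Adj m (.inl (Function.update s a (s' a))) := hline
    refine h1.reachable.trans (h2.reachable.trans (ih _ _ fun j hj => ?_))
    by_cases hja : j = a
    · subst hja; simp
    · rw [Function.update_of_ne hja]
      exact h j (by simp [hja, hj])

variable [Fintype ι]

theorem lineCliqueGraph_connected (hb : ∀ i, 0 < b i) (hx : ∀ i, 0 < x i) :
    (lineCliqueGraph x b).Connected := by
  let o : GridPoint x := fun i => ⟨0, hx i⟩
  have hpt (s : GridPoint x) : (lineCliqueGraph x b).Reachable (.inl s) (.inl o) :=
    lineCliqueGraph_reachable_points hb Finset.univ s o (by simp)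
  have hall (v : LineCliqueVertex x b) : (lineCliqueGraph x b).Reachable v (.inl o) := by
    rcases v with s | ⟨⟨i, l⟩, k⟩
    · exact hpt s
    · let s : GridPoint x := fun j => if h : j ≠ i then l ⟨j, h⟩ else ⟨0, hx j⟩
      have hs : (lineCliqueGraph x b).Adj (.inr ⟨⟨i, l⟩, k⟩) (.inl s) := by
        change s.line i = l
        funext j
        simp [s, GridPoint.line, j.2]
      exact hs.reachable.trans (hpt s)
  have : Nonempty (LineCliqueVertex x b) := ⟨.inl o⟩
  exact ⟨fun u v => (hall u).trans (hall v).symm⟩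

theorem card_points_on_line (i : ι) (l : GridLine x i) :
    (Finset.univ.filter fun s : GridPoint x => s.line i = l).card = x i := by
  rw [← Fintype.card_fin (x i), ← Finset.card_univ]
  refine Finset.card_bij' (fun s _ => s i)
    (fun c _ j => if h : j ≠ i then l ⟨j, h⟩ else (not_not.1 h).symm ▸ c) ?_ ?_ ?_ ?_
  · simp
  · intro c _
    simp only [Finset.mem_filter, Finset.mem_univ, true_and]
    funext j
    simp [GridPoint.line, j.2]
  · intro s hs
    simp only [Finset.mem_filter, Finset.mem_univ, true_and] at hs
    funext j
    by_cases h : j = i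
    · subst h; simp
    · simp [h, ← hs, GridPoint.line]
  · intro c _
    simp

variable [DecidableRel (lineCliqueGraph x b).Adj]

theorem sum_neighborFinset_point (g : LineCliqueVertex x b → ℕ) (g₁ : ι → ℕ)
    (hg : ∀ u, g (.inr u) = g₁ u.1.1) (s : GridPoint x) :
    ∑ v ∈ (lineCliqueGraph x b).neighborFinset (.inl s), g v = ∑ i, b i * g₁ i := by
  rw [neighborFinset_eq_filter, Finset.sum_filter, Fintype.sum_sum_type, Fintype.sum_sigma,
    Fintype.sum_sigma]
  simp [lineCliqueGraph, hg]

theorem sum_neighborFinset_block (g : LineCliqueVertex x b → ℕ) (g₀ : ℕ) (g₁ : ι → ℕ)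
    (hg₀ : ∀ s, g (.inl s) = g₀) (hg : ∀ u, g (.inr u) = g₁ u.1.1)
    (u : Σ l : (Σ i, GridLine x i), Fin (b l.1)) :
    ∑ v ∈ (lineCliqueGraph x b).neighborFinset (.inr u), g v =
      x u.1.1 * g₀ + (b u.1.1 - 1) * g₁ u.1.1 := by
  obtain ⟨⟨i, l⟩, k⟩ := u
  rw [neighborFinset_eq_filter, Finset.sum_filter, Fintype.sum_sum_type]
  congr 1
  · rw [← card_points_on_line i l, ← smul_eq_mul, ← Finset.sum_const, Finset.sum_filter]
    simp [lineCliqueGraph, hg₀]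
  · rw [Fintype.sum_sigma, Finset.sum_eq_single ⟨i, l⟩]
    · have hk : (Finset.univ.filter fun k' : Fin (b i) => ¬ k = k').card = b i - 1 := by
        have : (Finset.univ.filter fun k' : Fin (b i) => ¬ k = k') = Finset.univ.erase k := by
          ext k'; simp [eq_comm]
        rw [this, Finset.card_erase_of_mem (Finset.mem_univ _), Finset.card_fin]
      simp only [lineCliqueGraph, hg, and_true, ne_eq, Sigma.mk.injEq, heq_eq_eq, true_and]
      rw [← Finset.sum_filter, Finset.sum_const, hk, smul_eq_mul]
    · intro l' _ hl'
      apply Finset.sum_eq_zero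
      intro k' _
      rw [if_neg]
      exact fun h => hl' h.2.symm
    · simp

theorem degree_lineCliqueGraph_point (s : GridPoint x) :
    (lineCliqueGraph x b).degree (.inl s) = ∑ i, b i := by
  rw [← card_neighborFinset_eq_degree, Finset.card_eq_sum_ones,
    sum_neighborFinset_point (fun _ => 1) (fun _ => 1) (fun _ => rfl)]
  simp

theorem degree_lineCliqueGraph_block (u : Σ l : (Σ i, GridLine x i), Fin (b l.1)) :
    (lineCliqueGraph x b).degree (.inr u) = x u.1.1 + (b u.1.1 - 1) := by
  rw [← card_neighborFinset_eq_degree, Finset.card_eq_sum_ones,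
    sum_neighborFinset_block (fun _ => 1) 1 (fun _ => 1) (fun _ => rfl) (fun _ => rfl)]
  simp

/-- Point vertices have valency `B = ∑ j, b j` and the blocks in direction `i` have valency
`B - δ i`; the condition `δ i * (b i + M) = ∑ j, b j * δ j` is then what 2-walk linearity with
`α = B - 1 - M` amounts to at the block vertices. -/
theorem sum_degree_lineCliqueGraph {δ : ι → ℕ} {M : ℕ} (hb : ∀ i, 0 < b i)
    (hdeg : ∀ i, x i + b i + δ i = ∑ j, b j + 1)
    (hlin : ∀ i, δ i * (b i + M) = ∑ j, b j * δ j) (v : LineCliqueVertex x b) :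
    ((∑ u ∈ (lineCliqueGraph x b).neighborFinset v, (lineCliqueGraph x b).degree u : ℕ) : ℤ) =
      ((∑ j, b j : ℕ) - 1 - M : ℤ) * (lineCliqueGraph x b).degree v +
        ((∑ j, b j : ℕ) * (M + 1) - (∑ j, b j * δ j : ℕ)) := by
  have hval (i) : ((x i + (b i - 1) : ℕ) : ℤ) = (∑ j, b j : ℕ) - δ i := by
    have := hdeg i
    have := hb i
    omega
  rcases v with s | u
  · rw [sum_neighborFinset_point _ (fun i => x i + (b i - 1)) degree_lineCliqueGraph_block,
      degree_lineCliqueGraph_point, Nat.cast_sum]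
    simp only [Nat.cast_mul, hval, mul_sub, Finset.sum_sub_distrib, ← Finset.sum_mul, Nat.cast_sum]
    ring
  · rw [sum_neighborFinset_block _ _ (fun i => x i + (b i - 1)) degree_lineCliqueGraph_point
      degree_lineCliqueGraph_block, degree_lineCliqueGraph_block]
    obtain ⟨⟨i, l⟩, k⟩ := u
    simp only [Nat.cast_add (x i * _), Nat.cast_mul, hval, ← hlin i]
    have h1 : ((b i - 1 : ℕ) : ℤ) = b i - 1 := by have := hb i; omega
    have h2 : (x i : ℤ) = (∑ j, b j : ℕ) - δ i - (b i - 1) := by have := hdeg i; omega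
    rw [h1, h2]
    push_cast
    ring

end LineCliqueGraph

end SimpleGraph

/-! ### Solving for the block sizes -/

/-- Block sizes exist with `δ` running through `t + 1` consecutive integers, all so large that their
ratios are close to `1`. If `S` is the sum of the `δ i` and `Q` a common multiple, then
`b i = Q * (S - t * δ i) / δ i` and `M = t * Q` solve the equations, with common value `Q * S`. -/
theorem exists_blockSizes (t : ℕ) (ht : 0 < t) :
    ∃ (δ b x : Fin (t + 1) → ℕ) (M : ℕ), Function.Injective δ ∧ (∀ i, 0 < δ i) ∧
      (∀ i, 0 < b i) ∧ (∀ i, 0 < x i) ∧ M + 1 ≤ ∑ j, b j ∧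
      (∀ i, x i + b i + δ i = ∑ j, b j + 1) ∧
      (∀ i, δ i * (b i + M) = ∑ j, b j * δ j) := by
  -- This `D` makes every `b i` exceed `t * Q / (t + 1)`.
  obtain ⟨D, hD⟩ : ∃ D, D = t ^ 2 * (t + 2) + 1 := ⟨_, rfl⟩
  obtain ⟨δ, hδ⟩ : ∃ δ : Fin (t + 1) → ℕ, ∀ i, δ i = D + i := ⟨fun i => D + i, fun _ => rfl⟩
  have hδpos (i) : 0 < δ i := by rw [hδ, hD]; omega
  obtain ⟨S, hS⟩ : ∃ S, S = ∑ j, δ j := ⟨_, rfl⟩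
  obtain ⟨P, hP⟩ : ∃ P, P = ∏ j, δ j := ⟨_, rfl⟩
  have hPpos : 0 < P := hP ▸ Finset.prod_pos fun i _ => hδpos i
  have hSD : (t + 1) * D ≤ S := by
    have := Finset.card_nsmul_le_sum Finset.univ δ D (fun i _ => by rw [hδ]; omega)
    simpa [hS] using this
  have hgap (i) : ∃ c, S = t * δ i + c ∧ t * δ i < (t + 1) * c := by
    have hi : (i : ℕ) ≤ t := Nat.lt_succ_iff.1 i.2
    have h1 : t * δ i ≤ t * D + t ^ 2 := by rw [hδ]; nlinarith
    have h2 : t * D + t ^ 2 ≤ S := by nlinarith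
    refine ⟨S - t * δ i, by omega, ?_⟩
    have h3 : D ≤ (S - t * δ i) + t ^ 2 := by
      have : (t + 1) * D = t * D + D := by ring
      omega
    have h4 := Nat.mul_le_mul_left (t + 1) h3
    nlinarith
  choose c hc hcpos using hgap
  have hdvd (i) : ∃ q, P = δ i * q := hP ▸ Finset.dvd_prod_of_mem δ (Finset.mem_univ i)
  choose q hq using hdvd
  have hqpos (i) : 0 < q i := Nat.pos_of_ne_zero fun h => by
    have := hq i; rw [h] at this; omega
  have hbδ (i) : δ i * (2 * q i * c i) = 2 * P * c i := by rw [hq i]; ring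
  have hblarge (i) : t * (2 * P) < (t + 1) * (2 * q i * c i) := by
    have h1 : t * (2 * P) = 2 * q i * (t * δ i) := by rw [hq i]; ring
    have h2 : (t + 1) * (2 * q i * c i) = 2 * q i * ((t + 1) * c i) := by ring
    rw [h1, h2]
    exact Nat.mul_lt_mul_of_pos_left (hcpos i) (Nat.mul_pos two_pos (hqpos i))
  -- The common multiple is `Q = 2 * P`; the factor `2` gives `P < b i`, which leaves room for
  -- `δ j ≤ P` in `0 < x j`.
  have hbP (i) : P < 2 * q i * c i := by
    have := hblarge i
    by_contra! hle
    nlinarith [Nat.mul_le_mul_left (t + 1) hle, Nat.mul_le_mul_right P ht]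
  have hx (i) : 2 * q i * c i + δ i ≤ ∑ j, 2 * q j * c j := by
    obtain ⟨j, hj⟩ : ∃ j, j ≠ i := by
      have : Nontrivial (Fin (t + 1)) := Fin.nontrivial_iff_two_le.2 (by omega)
      exact exists_ne i
    have h1 : 2 * q i * c i + 2 * q j * c j ≤ ∑ j, 2 * q j * c j := by
      rw [← Finset.sum_pair (f := fun j => 2 * q j * c j) hj.symm]
      exact Finset.sum_le_sum_of_subset (Finset.subset_univ _)
    have h2 : δ i ≤ P := by rw [hq i]; exact Nat.le_mul_of_pos_right _ (hqpos i)
    have := hbP j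
    omega
  refine ⟨δ, fun i => 2 * q i * c i, fun i => ∑ j, 2 * q j * c j + 1 - 2 * q i * c i - δ i,
    t * (2 * P), ?_, hδpos, ?_, ?_, ?_, ?_, ?_⟩
  · intro i j hij
    rw [hδ, hδ] at hij
    exact Fin.ext (by omega)
  · intro i
    have := hbP i
    show 0 < 2 * q i * c i
    omega
  · intro i
    have := hx i
    show 0 < ∑ j, 2 * q j * c j + 1 - 2 * q i * c i - δ i
    omega
  · show t * (2 * P) < ∑ j, 2 * q j * c j
    have h1 : ∑ _j : Fin (t + 1), t * (2 * P) < ∑ j, (t + 1) * (2 * q j * c j) :=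
      Finset.sum_lt_sum_of_nonempty Finset.univ_nonempty fun i _ => hblarge i
    rw [Finset.sum_const, Finset.card_fin, smul_eq_mul, ← Finset.mul_sum] at h1
    exact Nat.lt_of_mul_lt_mul_left h1
  · intro i
    have := hx i
    show (∑ j, 2 * q j * c j + 1 - 2 * q i * c i - δ i) + 2 * q i * c i + δ i =
      ∑ j, 2 * q j * c j + 1
    omega
  · have hcsum : ∑ j, c j = S := by
      have h1 : ∑ j, S = ∑ j, (t * δ j + c j) := Finset.sum_congr rfl fun j _ => hc j
      rw [Finset.sum_add_distrib, ← Finset.mul_sum, ← hS, Finset.sum_const, Finset.card_fin,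
        smul_eq_mul, add_mul, one_mul] at h1
      omega
    intro i
    have h2 : ∑ j, 2 * q j * c j * δ j = 2 * P * S := by
      rw [← hcsum, Finset.mul_sum]
      exact Finset.sum_congr rfl fun j _ => by rw [mul_comm, hbδ]
    rw [h2, mul_add, hbδ]
    conv_rhs => rw [hc i]
    ring

/-! ### Unboundedly many valencies -/

theorem mainTheorem2 (t : ℕ) (ht : 0 < t) :
    ∃ (n : ℕ) (G : SimpleGraph (Fin n)) (_ : DecidableRel G.Adj) (α β : ℤ),
      0 ≤ α ∧ G.Connected ∧ G.IsTwoWalkLinear (α : ℝ) (β : ℝ) ∧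
        G.HasExactlyMainEigenvalues 2 ∧ t ≤ G.valencies.card := by
  obtain ⟨δ, b, x, M, hinj, hδ, hb, hx, hM, hdeg, hlin⟩ := exists_blockSizes t ht
  let H := SimpleGraph.lineCliqueGraph x b
  let e := Fintype.equivFin (SimpleGraph.LineCliqueVertex x b)
  let G := H.map e.toEmbedding
  let _ : DecidableRel H.Adj := Classical.decRel _
  let _ : DecidableRel G.Adj := Classical.decRel _
  let φ : H ≃g G := SimpleGraph.Iso.map e H
  have hφdeg (v) : G.degree (φ v) = H.degree v := φ.degree_eq v
  let o : SimpleGraph.GridPoint x := fun i => ⟨0, hx i⟩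
  let u (i : Fin (t + 1)) : SimpleGraph.LineCliqueVertex x b := .inr ⟨⟨i, o.line i⟩, ⟨0, hb i⟩⟩
  have hpoint : H.degree (.inl o) = ∑ j, b j := SimpleGraph.degree_lineCliqueGraph_point o
  have hblock (i) : H.degree (u i) + δ i = ∑ j, b j := by
    have h1 : H.degree (u i) = x i + (b i - 1) := SimpleGraph.degree_lineCliqueGraph_block _
    have := hdeg i
    have := hb i
    omega
  have hreg : ¬ ∃ k : ℕ, G.IsRegularOfDegree k := by
    rintro ⟨k, hk⟩
    have h1 := (hφdeg _).symm.trans (hk (φ (.inl o)))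
    have h2 := (hφdeg _).symm.trans (hk (φ (u 0)))
    have := hblock 0
    have := hδ 0
    omega
  have htwo := SimpleGraph.isTwoWalkLinear_of_sum_degree (G := G)
    (α := (∑ j, b j : ℕ) - 1 - M)
    (β := (∑ j, b j : ℕ) * (M + 1) - (∑ j, b j * δ j : ℕ)) hreg (by
      intro w
      obtain ⟨v, rfl⟩ := φ.surjective w
      rw [hφdeg, ← SimpleGraph.sum_degree_lineCliqueGraph hb hdeg hlin v]
      congr 1
      refine (Finset.sum_bij (fun a _ => φ a) ?_ ?_ ?_ ?_).symm
      · intro a ha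
        exact (SimpleGraph.mem_neighborFinset ..).2
          (φ.map_adj_iff.2 ((SimpleGraph.mem_neighborFinset ..).1 ha))
      · intro a _ a' _ h
        exact φ.injective h
      · intro y hy
        obtain ⟨a, rfl⟩ := φ.surjective y
        exact ⟨a, (SimpleGraph.mem_neighborFinset ..).2
          (φ.map_adj_iff.1 ((SimpleGraph.mem_neighborFinset ..).1 hy)), rfl⟩
      · intro a _
        exact (hφdeg a).symm)
  refine ⟨_, G, inferInstance, _, _, by omega, ?_, htwo, htwo.hasExactlyMainEigenvalues_two, ?_⟩
  · exact φ.connected_iff.1 (SimpleGraph.lineCliqueGraph_connected hb hx)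
  · have hcard : (Finset.univ.image fun i => H.degree (u i)).card = t + 1 := by
      rw [Finset.card_image_of_injective, Finset.card_fin]
      intro i j hij
      apply hinj
      have h1 := hblock i
      have h2 := hblock j
      simp only at hij
      omega
    refine (Nat.le_succ t).trans (hcard.symm.trans_le (Finset.card_le_card ?_))
    intro k hk
    obtain ⟨i, -, rfl⟩ := Finset.mem_image.1 hk
    exact Finset.mem_image.2 ⟨φ (u i), Finset.mem_univ _, hφdeg _⟩
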